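/- **Theorem.** Let $\mathcal C$ be the circle of center $O$ and radius $1$ in the Euclidean plane and let $\mathcal T_0=(A_0B_0C_0D_0)$ be a convex quadrilateral, with vertices taken in this order, pairwise distinct and lying on $\mathcal C$. Given a quadrilateral $\mathcal T_n=(A_nB_nC_nD_n)$ with vertices on $\mathcal C$, let $G_n=\frac14(A_n+B_n+C_n+D_n)$ be its centroid, and let $A_{n+1},B_{n+1},C_{n+1},D_{n+1}$ be the points where the lines $G_nA_n,G_nB_n,G_nC_n,G_nD_n$ meet $\mathcal C$ for the second time; put $\mathcal T_{n+1}=(A_{n+1}B_{n+1}C_{n+1}D_{n+1})$. Number the vertices $1,2,3,4$ in the order $A,B,C,D$, and for a quadrilateral let $d_{ij}$ denote the square of the distance between its vertices $i$ and $j$; $d_{ij}$ without further marks refers to $\mathcal T_0$. 1. The sequence $(\mathcal T_n)_{n\ge 0}$ is well defined: for every $n$, $G_n$ is different from each vertex of $\mathcal T_n$, each of the four lines meets $\mathcal C$ in exactly two distinct points, and $\mathcal T_n$ is a convex quadrilateral with pairwise distinct vertices on $\mathcal C$. 2. The sequences $(\mathcal T_{2i})_i$ and $(\mathcal T_{2i+1})_i$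 converge, vertex by vertex, to (nondegenerate) rectangles $\mathcal T^\infty$ and $\mathcal T'^\infty$ that have the same image (the same set of vertices) and centroid $O$. For both rectangles the squared edge lengths are $$d_{13}^\infty=4,\qquad d_{12}^\infty=4\,\frac{\sqrt{d_{12}d_{34}}}{\sqrt{d_{13}d_{24}}},\qquad d_{14}^\infty=4-d_{12}^\infty .$$ In particular both are squares or neither is. 3. If the limit rectangles are not squares, then $$OG_{n+1}\sim\frac{|d_{12}^\infty-2|}{2}\,OG_n\qquad(n\to\infty),$$ where $u_n\sim v_n$ means $u_n-v_n=o(v_n)$, and the convergence is at least geometric: there is $q\in(0,1)$ such that the distances of the vertices of $\mathcal T_{2i}$ and $\mathcal T_{2i+1}$ to the corresponding vertices of $\mathcal T^\infty$ and $\mathcal T'^\infty$ are $O(q^i)$. 4. If the limit rectangles are squares, then the convergence is faster: $OG_{n+1}=O\big(OG_n^{3/2}\big)$, and the distances in 3 are $O(q^i)$ for every $q\in(0,1)$. -/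

import Mathlib

open scoped RealInnerProductSpace

noncomputable section

namespace CyclicQuad

/-- The circle of center `O = 0` and radius `1` in the Euclidean plane `ℂ`. -/
def circle : EuclideanGeometry.Sphere ℂ := ⟨0, 1⟩

/-- The centroid (isobarycenter of the four vertices) of the quadrilateral `P 0 P 1 P 2 P 3`. -/
def centroid (P : Fin 4 → ℂ) : ℂ := Finset.univ.centroid ℝ P

/-- The transformation `P ↦ P'`: the vertex `P' i` is the second point where the line through
the vertex `P i` and the centroid meets the circle. -/
def next (P : Fin 4 → ℂ) : Fin 4 → ℂ :=
  fun i => circle.secondInter (P i) (centroid P -ᵥ P i)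

/-- The sequence of quadrilaterals obtained by iterating the transformation from `P`. -/
def seq (P : Fin 4 → ℂ) (n : ℕ) : Fin 4 → ℂ := next^[n] P

/-- The distance `O Gₙ` from the center of the circle to the centroid of the `n`-th
quadrilateral. -/
def OG (P : Fin 4 → ℂ) (n : ℕ) : ℝ := dist (0 : ℂ) (centroid (seq P n))

/-- The squared length of the edge (or diagonal) joining the vertices `i` and `j`;
the vertices are numbered from `0`, so that `d₁₂` is `d P 0 1`. -/
def d (P : Fin 4 → ℂ) (i j : Fin 4) : ℝ := dist (P i) (P j) ^ 2

/-- The quadrilateral with consecutive vertices `P 0, P 1, P 2, P 3` is convex: the line through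
two consecutive vertices leaves the two other vertices strictly on the same side. -/
def IsConvexQuad (P : Fin 4 → ℂ) : Prop :=
  ∀ i : Fin 4, (line[ℝ, P i, P (i + 1)]).SSameSide (P (i + 2)) (P (i + 3))

/-- `P 0 P 1 P 2 P 3` is a (nondegenerate) rectangle: a parallelogram with a right angle. -/
structure IsRectangle (P : Fin 4 → ℂ) : Prop where
  injective : Function.Injective P
  parallelogram : P 1 - P 0 = P 2 - P 3
  right_angle : ⟪P 1 - P 0, P 3 - P 0⟫ = 0

/-- `P 0 P 1 P 2 P 3` is a square: a rectangle with two adjacent sides of equal length. -/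
structure IsSquareQuad (P : Fin 4 → ℂ) : Prop extends IsRectangle P where
  adjacent_sides : dist (P 0) (P 1) = dist (P 1) (P 2)

/-- `P` is a rectangle with centroid `O`, whose squared edge lengths are given by the
parameters of `T₀`. -/
structure IsLimitForm (T₀ P : Fin 4 → ℂ) : Prop extends IsRectangle P where
  centroid_eq : centroid P = 0
  d13 : d P 0 2 = 4
  d12 : d P 0 1 = 4 * (√(d T₀ 0 1 * d T₀ 2 3) / √(d T₀ 0 2 * d T₀ 1 3))
  d14 : d P 0 3 = 4 - d P 0 1

end CyclicQuad

end

/-! ### The disc automorphism on the unit circle. -/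

namespace CyclicQuad

open Complex ComplexConjugate

/-! The line through `a` on the circle and `g` inside it meets the circle again at `-mob g a`
(`secondInter_eq`), and negating both arguments negates `mob`. So, up to the sign `(-1)^n`, the
quadrilaterals are the iterates of `step`, which applies one disc automorphism to all four vertices.
This keeps convexity and the ratios of the three products of opposite edges: all are multiplied by
the same `gain`.

Centering at the centroid `g` makes the squares `‖P i - g‖ ^ 2` average to `1 - ‖g‖ ^ 2`, so AM-GM
gives `1 ≤ gain P`. The products increase and are bounded by 4, hence the vertices stay uniformly
apart and the products have positive limits. A quantitative AM-GM then bounds `‖g‖ ^ 2` by a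
multiple of their increments, so the centroids tend to 0 (`tendsto_norm_centroid`).

To first order in `g`, `step` sends the centroid to `conj g * meanSq P`. Separation keeps `‖meanSq
P‖` away from 1, so the centroids decay geometrically; a vertex moves by at most a multiple of
`‖g‖`, and the iterates converge. The limit has centroid 0, hence consists of two antipodal pairs,
which convexity forces to be the diagonals; the conserved ratio gives its edges. The rate is
`‖meanSq E‖`, zero exactly for a square; there `‖meanSq P‖` is itself `O(‖g‖)`, and the decay is
quadratic. -/

theorem mem_circle_iff {z : ℂ} : z ∈ circle ↔ ‖z‖ = 1 := by
  simp [circle, EuclideanGeometry.mem_sphere]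

theorem centroid_eq (P : Fin 4 → ℂ) : centroid P = (P 0 + P 1 + P 2 + P 3) / 4 := by
  rw [centroid, Finset.centroid_def, Finset.affineCombination_eq_linear_combination]
  · simp [Fin.sum_univ_four, Finset.centroidWeights]
    ring
  · simp

theorem centroid_neg (P : Fin 4 → ℂ) : centroid (-P) = -centroid P := by
  simp only [centroid_eq, Pi.neg_apply]; ring

/-- The automorphism of the unit disc that sends `g` to `0`, with real derivative at `g`. -/
noncomputable def mob (g a : ℂ) : ℂ := (a - g) / (1 - conj g * a)

theorem mul_conj_eq_one {a : ℂ} (ha : ‖a‖ = 1) : a * conj a = 1 := by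
  rw [Complex.mul_conj, Complex.normSq_eq_norm_sq, ha]; simp

theorem ne_zero_of_norm_eq_one {a : ℂ} (ha : ‖a‖ = 1) : a ≠ 0 := by
  rintro rfl; simp at ha

theorem conj_eq_inv {a : ℂ} (ha : ‖a‖ = 1) : conj a = a⁻¹ :=
  eq_inv_of_mul_eq_one_right (mul_conj_eq_one ha)

theorem one_sub_conj_mul {g a : ℂ} (ha : ‖a‖ = 1) : 1 - conj g * a = a * conj (a - g) := by
  rw [map_sub, mul_sub, mul_conj_eq_one ha]; ring

theorem norm_one_sub_conj_mul {g a : ℂ} (ha : ‖a‖ = 1) : ‖1 - conj g * a‖ = ‖a - g‖ := by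
  rw [one_sub_conj_mul ha, norm_mul, ha, one_mul, Complex.norm_conj]

theorem sub_ne_zero_of_norm_lt {g a : ℂ} (ha : ‖a‖ = 1) (hg : ‖g‖ < 1) : a - g ≠ 0 := by
  rw [sub_ne_zero]; rintro rfl; exact hg.ne ha

theorem one_sub_conj_mul_ne_zero {g a : ℂ} (ha : ‖a‖ = 1) (hg : ‖g‖ < 1) :
    1 - conj g * a ≠ 0 := by
  rw [← norm_ne_zero_iff, norm_one_sub_conj_mul ha, norm_ne_zero_iff]
  exact sub_ne_zero_of_norm_lt ha hg

theorem norm_mob {g a : ℂ} (ha : ‖a‖ = 1) (hg : ‖g‖ < 1) : ‖mob g a‖ = 1 := by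
  rw [mob, norm_div, norm_one_sub_conj_mul ha, div_self]
  exact norm_ne_zero_iff.2 (sub_ne_zero_of_norm_lt ha hg)

theorem mob_neg (g a : ℂ) : mob (-g) (-a) = -mob g a := by
  simp only [mob, map_neg, neg_mul_neg]; rw [← neg_div]; ring

theorem mob_sub_mob {g a b : ℂ} (ha : ‖a‖ = 1) (hb : ‖b‖ = 1) (hg : ‖g‖ < 1) :
    mob g a - mob g b =
      (1 - g * conj g) * (a - b) / ((1 - conj g * a) * (1 - conj g * b)) := by
  have h1 := one_sub_conj_mul_ne_zero ha hg
  have h2 := one_sub_conj_mul_ne_zero hb hg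
  rw [mob, mob, div_sub_div _ _ h1 h2]
  ring

theorem norm_mob_sub_mob {g a b : ℂ} (ha : ‖a‖ = 1) (hb : ‖b‖ = 1) (hg : ‖g‖ < 1) :
    ‖mob g a - mob g b‖ = ‖a - b‖ * (1 - ‖g‖ ^ 2) / (‖a - g‖ * ‖b - g‖) := by
  rw [mob_sub_mob ha hb hg, norm_div, norm_mul, norm_mul, norm_one_sub_conj_mul ha,
    norm_one_sub_conj_mul hb, Complex.mul_conj, Complex.normSq_eq_norm_sq]
  have : ‖(1 : ℂ) - ((‖g‖ ^ 2 : ℝ) : ℂ)‖ = 1 - ‖g‖ ^ 2 := by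
    rw [← Complex.ofReal_one, ← Complex.ofReal_sub, Complex.norm_real, Real.norm_eq_abs,
      abs_of_nonneg]
    nlinarith [norm_nonneg g]
  rw [this]; ring

theorem mob_sub_self {g a : ℂ} (ha : ‖a‖ = 1) (hg : ‖g‖ < 1) :
    mob g a - a = (conj g * a ^ 2 - g) / (1 - conj g * a) := by
  have h1 := one_sub_conj_mul_ne_zero ha hg
  rw [mob, eq_div_iff h1, sub_mul, div_mul_cancel₀ _ h1]; ring

theorem norm_mob_sub_self_le {g a : ℂ} (ha : ‖a‖ = 1) (hg : ‖g‖ ≤ 1 / 2) :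
    ‖mob g a - a‖ ≤ 4 * ‖g‖ := by
  rw [mob_sub_self ha (by linarith), norm_div, norm_one_sub_conj_mul ha]
  have h1 : ‖conj g * a ^ 2 - g‖ ≤ 2 * ‖g‖ := by
    refine (norm_sub_le _ _).trans ?_
    rw [norm_mul, norm_pow, ha, Complex.norm_conj]; linarith
  have h2 : 1 / 2 ≤ ‖a - g‖ := by
    have := norm_sub_norm_le a g
    linarith
  rw [div_le_iff₀ (by linarith)]
  nlinarith [norm_nonneg g]

/-- The remainder is exactly `(mob g a - a) * (conj g * a)`, a product of two factors of order
`‖g‖`. -/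
theorem norm_mob_sub_le {g a : ℂ} (ha : ‖a‖ = 1) (hg : ‖g‖ ≤ 1 / 2) :
    ‖mob g a - (a + conj g * a ^ 2 - g)‖ ≤ 4 * ‖g‖ ^ 2 := by
  have hg' : ‖g‖ < 1 := by linarith
  have h0 := one_sub_conj_mul_ne_zero ha hg'
  have h : mob g a - (a + conj g * a ^ 2 - g) = (mob g a - a) * (conj g * a) := by
    rw [mob]
    generalize conj g = c at *
    rw [div_sub' h0, div_sub' h0, div_mul_eq_mul_div]
    congr 1
    ring
  rw [h, norm_mul, norm_mul, ha, Complex.norm_conj]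
  have := norm_mob_sub_self_le ha hg
  nlinarith [norm_nonneg g]

/-! ### Orientation of triples and convexity. -/

/-- Twice the signed area of the triangle `u v w`. -/
noncomputable def orient (u v w : ℂ) : ℝ := (conj (v - u) * (w - u)).im

theorem orient_neg (u v w : ℂ) : orient (-u) (-v) (-w) = orient u v w := by
  simp only [orient]
  rw [show -v - -u = -(v - u) by ring, show -w - -u = -(w - u) by ring, map_neg, neg_mul_neg]

/-- Since `conj` is inversion on the unit circle, the area becomes a product of differences, the
form on which `mob` acts factor by factor. -/
theorem ofReal_orient {u v w : ℂ} (hu : ‖u‖ = 1) (hv : ‖v‖ = 1) (hw : ‖w‖ = 1) :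
    2 * I * (orient u v w : ℂ) = (u - v) * (v - w) * (u - w) / (u * v * w) := by
  have h0 := ne_zero_of_norm_eq_one hu
  have h1 := ne_zero_of_norm_eq_one hv
  have h2 := ne_zero_of_norm_eq_one hw
  have h := Complex.sub_conj (conj (v - u) * (w - u))
  rw [orient, mul_comm (2 * I) _, ← mul_assoc]
  rw [Complex.ofReal_mul, Complex.ofReal_ofNat] at h
  rw [mul_comm (_ : ℂ) 2, ← h]
  simp only [map_sub, map_mul, Complex.conj_conj]
  simp only [conj_eq_inv hu, conj_eq_inv hv, conj_eq_inv hw]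
  field_simp
  ring

theorem orient_sq {u v w : ℂ} (hu : ‖u‖ = 1) (hv : ‖v‖ = 1) (hw : ‖w‖ = 1) :
    4 * orient u v w ^ 2 = ‖u - v‖ ^ 2 * ‖v - w‖ ^ 2 * ‖u - w‖ ^ 2 := by
  have h := congrArg (fun z : ℂ => ‖z‖ ^ 2) (ofReal_orient hu hv hw)
  simp only [norm_mul, norm_div, hu, hv, hw, Complex.norm_real, Complex.norm_I,
    Complex.norm_ofNat, Real.norm_eq_abs, mul_pow, sq_abs] at h
  norm_num [mul_pow] at h
  linarith

theorem orient_mob {g u v w : ℂ} (hu : ‖u‖ = 1) (hv : ‖v‖ = 1) (hw : ‖w‖ = 1) (hg : ‖g‖ < 1) :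
    orient (mob g u) (mob g v) (mob g w) =
      orient u v w * ((1 - ‖g‖ ^ 2) ^ 3 / (‖u - g‖ ^ 2 * ‖v - g‖ ^ 2 * ‖w - g‖ ^ 2)) := by
  -- This trades the squared denominators produced by `mob_sub_mob` for positive real factors.
  have key : ∀ {a : ℂ}, ‖a‖ = 1 →
      (1 - conj g * a) ^ 2 * mob g a = a * ((‖a - g‖ ^ 2 : ℝ) : ℂ) := by
    intro a ha
    have h0 := one_sub_conj_mul_ne_zero ha hg
    rw [← Complex.normSq_eq_norm_sq, ← Complex.mul_conj, mob, sq, mul_assoc,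
      mul_div_cancel₀ _ h0, one_sub_conj_mul ha]
    ring
  have hs : ((‖g‖ ^ 2 : ℝ) : ℂ) = g * conj g := by
    rw [Complex.mul_conj, Complex.normSq_eq_norm_sq]
  have h2I : (2 * I : ℂ) ≠ 0 := by simp
  apply Complex.ofReal_injective
  apply mul_left_cancel₀ h2I
  rw [ofReal_orient (norm_mob hu hg) (norm_mob hv hg) (norm_mob hw hg), Complex.ofReal_mul,
    ← mul_assoc, ofReal_orient hu hv hw, mob_sub_mob hu hv hg, mob_sub_mob hv hw hg,
    mob_sub_mob hu hw hg, Complex.ofReal_div, Complex.ofReal_pow, Complex.ofReal_sub, hs,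
    Complex.ofReal_mul, Complex.ofReal_mul, Complex.ofReal_one]
  have a1 := one_sub_conj_mul_ne_zero hu hg
  have a2 := one_sub_conj_mul_ne_zero hv hg
  have a3 := one_sub_conj_mul_ne_zero hw hg
  have b1 := ne_zero_of_norm_eq_one (norm_mob hu hg)
  have b2 := ne_zero_of_norm_eq_one (norm_mob hv hg)
  have b3 := ne_zero_of_norm_eq_one (norm_mob hw hg)
  rw [div_mul_div_comm ((u - v) * (v - w) * (u - w)),
    show u * v * w * (((‖u - g‖ ^ 2 : ℝ) : ℂ) * ((‖v - g‖ ^ 2 : ℝ) : ℂ) *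
      ((‖w - g‖ ^ 2 : ℝ) : ℂ)) = (u * ((‖u - g‖ ^ 2 : ℝ) : ℂ)) * (v * ((‖v - g‖ ^ 2 : ℝ) : ℂ)) *
      (w * ((‖w - g‖ ^ 2 : ℝ) : ℂ)) by ring, ← key hu, ← key hv, ← key hw]
  generalize mob g u = U at *
  generalize mob g v = V at *
  generalize mob g w = W at *
  generalize 1 - conj g * u = x at *
  generalize 1 - conj g * v = y at *
  generalize 1 - conj g * w = z at *
  field_simp

theorem sSameSide_iff_orient {p q x y : ℂ} (hpq : p ≠ q) :
    (line[ℝ, p, q]).SSameSide x y ↔ 0 < orient p q x * orient p q y := by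
  have hqp : q - p ≠ 0 := sub_ne_zero.2 hpq.symm
  -- A linear form whose kernel is the direction of the line: its sign tells the sides apart.
  let f : ℂ →ₗ[ℝ] ℝ := Complex.imLm ∘ₗ LinearMap.mulLeft ℝ (conj (q - p))
  have hf : ∀ z, orient p q z = f (z - p) := fun z => rfl
  have hmem : ∀ z, z ∈ line[ℝ, p, q] ↔ f (z - p) = 0 := by
    intro z
    constructor
    · intro hz
      obtain ⟨t, rfl⟩ := mem_affineSpan_pair_iff_exists_lineMap_eq.1 hz
      rw [AffineMap.lineMap_apply, vsub_eq_sub, vadd_eq_add, add_sub_cancel_right, map_smul]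
      have : f (q - p) = 0 := by
        change (conj (q - p) * (q - p)).im = 0
        rw [mul_comm, Complex.mul_conj, Complex.ofReal_im]
      rw [this, smul_zero]
    · intro hz
      refine mem_affineSpan_pair_iff_exists_lineMap_eq.2 ⟨((z - p) / (q - p)).re, ?_⟩
      have him : ((z - p) / (q - p)).im = 0 := by
        have h1 : (z - p) / (q - p) =
            (conj (q - p) * (z - p)) * (((normSq (q - p))⁻¹ : ℝ) : ℂ) := by
          rw [div_eq_mul_inv, Complex.inv_def]; push_cast; ring
        have h2 : (conj (q - p) * (z - p)).im = 0 := hz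
        rw [h1, Complex.im_mul_ofReal, h2, zero_mul]
      have h3 : ((((z - p) / (q - p)).re : ℝ) : ℂ) = (z - p) / (q - p) :=
        Complex.ext (by simp) (by simp [him])
      rw [AffineMap.lineMap_apply, vsub_eq_sub, vadd_eq_add, Complex.real_smul, h3,
        div_mul_cancel₀ _ hqp, sub_add_cancel]
  have hp : p ∈ line[ℝ, p, q] := left_mem_affineSpan_pair ℝ p q
  rw [AffineSubspace.sSameSide_iff_exists_left hp, hmem, hmem, hf, hf]
  constructor
  · rintro ⟨hx, hy, p₂, hp₂, hr⟩
    have h1 := hr.map f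
    rw [vsub_eq_sub, vsub_eq_sub, show y - p₂ = (y - p) - (p₂ - p) by ring, map_sub f (y - p),
      (hmem _).1 hp₂, sub_zero] at h1
    obtain ⟨r, hr, h⟩ := (exists_pos_left_iff_sameRay hx hy).2 h1
    rw [← h, smul_eq_mul]
    have := mul_self_pos.2 hx
    nlinarith
  · intro h
    have hx : f (x - p) ≠ 0 := fun h0 => by simp [h0] at h
    have hy : f (y - p) ≠ 0 := fun h0 => by simp [h0] at h
    have ht : 0 < f (y - p) / f (x - p) := by
      rw [div_eq_mul_inv, ← mul_pos_iff_of_pos_right (mul_self_pos.2 hx)]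
      calc 0 < _ := h
        _ = _ := by field_simp
    refine ⟨hx, hy, y - (f (y - p) / f (x - p)) • (x - p), ?_, ?_⟩
    · rw [hmem, sub_right_comm, map_sub, map_smul, smul_eq_mul, div_mul_cancel₀ _ hx, sub_self]
    · rw [vsub_eq_sub, vsub_eq_sub, sub_sub_cancel]
      exact SameRay.sameRay_pos_smul_right _ ht

/-! ### The second intersection point. -/

theorem secondInter_eq {a g : ℂ} (ha : ‖a‖ = 1) (hg : ‖g‖ < 1) :
    circle.secondInter a (g -ᵥ a) = -mob g a := by
  have h0 := sub_ne_zero_of_norm_lt ha hg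
  have h0' : g - a ≠ 0 := by rw [← neg_sub]; exact neg_ne_zero.2 h0
  have h1 : conj (g - a) ≠ 0 := (map_ne_zero _).2 h0'
  have h1' : conj (a - g) ≠ 0 := (map_ne_zero _).2 h0
  have h2 := ne_zero_of_norm_eq_one ha
  have e1 : ((⟪g - a, a⟫ : ℝ) : ℂ) = (conj (g - a) * a + (g - a) * conj a) / 2 := by
    rw [Complex.inner, Complex.re_eq_add_conj]
    simp [mul_comm]
  have e2 : ((⟪g - a, g - a⟫ : ℝ) : ℂ) = (g - a) * conj (g - a) := by
    rw [real_inner_self_eq_norm_sq, Complex.mul_conj, Complex.normSq_eq_norm_sq]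
  rw [EuclideanGeometry.Sphere.secondInter, mob, one_sub_conj_mul ha]
  simp only [circle, vsub_eq_sub, vadd_eq_add, sub_zero, Complex.real_smul, Complex.ofReal_div,
    Complex.ofReal_mul, Complex.ofReal_neg, Complex.ofReal_ofNat, e1, e2]
  rw [show conj (a - g) = -conj (g - a) by rw [← map_neg, neg_sub]]
  generalize hb : conj (g - a) = b at *
  rw [conj_eq_inv ha]
  field_simp
  ring

theorem line_inter_circle {a g : ℂ} (ha : ‖a‖ = 1) :
    {z : ℂ | z ∈ line[ℝ, g, a] ∧ z ∈ circle} = {a, circle.secondInter a (g -ᵥ a)} := by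
  have ha' : a ∈ circle := mem_circle_iff.2 ha
  ext z
  simp only [Set.mem_ofPred_eq, Set.mem_insert_iff, Set.mem_singleton_iff]
  rw [Set.pair_comm]
  constructor
  · rintro ⟨hl, hz⟩
    exact (EuclideanGeometry.Sphere.eq_or_eq_secondInter_iff_mem_of_mem_affineSpan_pair ha' hl).2 hz
  · intro hz
    have hl : z ∈ line[ℝ, a, g] := by
      rcases hz with rfl | rfl
      · exact left_mem_affineSpan_pair ℝ _ _
      · exact smul_vsub_vadd_mem_affineSpan_pair _ _ _
    exact ⟨hl,
      (EuclideanGeometry.Sphere.eq_or_eq_secondInter_iff_mem_of_mem_affineSpan_pair ha' hl).1 hz⟩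

/-- Excludes tangency: equality would force `g + conj g * a ^ 2 = 2 * a`, whose left side has norm
below 2. -/
theorem neg_mob_ne_self {a g : ℂ} (ha : ‖a‖ = 1) (hg : ‖g‖ < 1) : -mob g a ≠ a := by
  intro h
  have h0 := one_sub_conj_mul_ne_zero ha hg
  rw [mob, ← neg_div, div_eq_iff h0] at h
  have h2 : g + conj g * a ^ 2 = 2 * a := by linear_combination h
  have h3 := congrArg norm h2
  have h4 := norm_add_le g (conj g * a ^ 2)
  rw [norm_mul, norm_pow, ha, Complex.norm_conj] at h4
  rw [norm_mul, ha, Complex.norm_ofNat] at h3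
  linarith

end CyclicQuad

/-! ### Inscribed quadrilaterals and their centroids. -/

namespace CyclicQuad

open Complex ComplexConjugate

/-- Four pairwise distinct points on the unit circle. -/
structure Inscribed (P : Fin 4 → ℂ) : Prop where
  norm_eq : ∀ i, ‖P i‖ = 1
  injective : Function.Injective P

/-- The transformation `P ↦ -next P`, written with the disc automorphism `mob`. -/
noncomputable def step (P : Fin 4 → ℂ) : Fin 4 → ℂ := fun i => mob (centroid P) (P i)

theorem step_neg (P : Fin 4 → ℂ) : step (-P) = -step P := by
  funext i
  rw [Pi.neg_apply, step, step, centroid_neg, Pi.neg_apply, mob_neg]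

theorem norm_sum_sq {a b c e : ℂ} (ha : ‖a‖ = 1) (hb : ‖b‖ = 1) (hc : ‖c‖ = 1) (he : ‖e‖ = 1) :
    ‖a + b + c + e‖ ^ 2 = 16 - (‖a - b‖ ^ 2 + ‖a - c‖ ^ 2 + ‖a - e‖ ^ 2 + ‖b - c‖ ^ 2 +
      ‖b - e‖ ^ 2 + ‖c - e‖ ^ 2) := by
  have h : ∀ z : ℂ, ‖z‖ = 1 → z.re * z.re + z.im * z.im = 1 := fun z hz => by
    rw [← Complex.normSq_apply, Complex.normSq_eq_norm_sq, hz, one_pow]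
  simp only [← Complex.normSq_eq_norm_sq, Complex.normSq_apply, Complex.add_re, Complex.add_im,
    Complex.sub_re, Complex.sub_im]
  linear_combination 4 * h a ha + 4 * h b hb + 4 * h c hc + 4 * h e he

namespace Inscribed

variable {P : Fin 4 → ℂ}

theorem norm_centroid_lt_one (h : Inscribed P) : ‖centroid P‖ < 1 := by
  have h1 := norm_sum_sq (h.norm_eq 0) (h.norm_eq 1) (h.norm_eq 2) (h.norm_eq 3)
  have h2 : 0 < ‖P 0 - P 1‖ :=
    norm_pos_iff.2 (sub_ne_zero.2 fun e => by simpa using h.injective e)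
  rw [centroid_eq, norm_div, Complex.norm_ofNat, div_lt_one (by norm_num)]
  have : ‖P 0 + P 1 + P 2 + P 3‖ ^ 2 < 4 ^ 2 := by rw [h1]; nlinarith
  exact lt_of_pow_lt_pow_left₀ 2 (by norm_num) this

theorem step (h : Inscribed P) : Inscribed (step P) := by
  have hg := h.norm_centroid_lt_one
  refine ⟨fun i => norm_mob (h.norm_eq i) hg, fun i j hij => h.injective ?_⟩
  have h1 := norm_mob_sub_mob (h.norm_eq i) (h.norm_eq j) hg
  rw [show mob _ (P i) = mob _ (P j) from hij, sub_self, norm_zero, eq_comm, div_eq_zero_iff] at h1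
  have hi := norm_pos_iff.2 (sub_ne_zero_of_norm_lt (h.norm_eq i) hg)
  have hj := norm_pos_iff.2 (sub_ne_zero_of_norm_lt (h.norm_eq j) hg)
  rcases h1 with h1 | h1
  · rcases mul_eq_zero.1 h1 with h2 | h2
    · exact sub_eq_zero.1 (norm_eq_zero.1 h2)
    · nlinarith [norm_nonneg (centroid P)]
  · exact absurd h1 (by positivity)

theorem iterate (h : Inscribed P) (n : ℕ) : Inscribed (CyclicQuad.step^[n] P) := by
  induction n with
  | zero => exact h
  | succ n ih => rw [Function.iterate_succ_apply']; exact ih.step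

theorem norm_sub_centroid_sq (h : Inscribed P) (i : Fin 4) :
    ‖P i - centroid P‖ ^ 2 =
      1 - ‖centroid P‖ ^ 2 + 2 * (‖centroid P‖ ^ 2 - ⟪centroid P, P i⟫) := by
  rw [norm_sub_sq_real, h.norm_eq, real_inner_comm]; ring

theorem sum_inner_centroid :
    ⟪centroid P, P 0⟫ + ⟪centroid P, P 1⟫ + ⟪centroid P, P 2⟫ + ⟪centroid P, P 3⟫ =
      4 * ‖centroid P‖ ^ 2 := by
  rw [← inner_add_right, ← inner_add_right, ← inner_add_right, ← real_inner_self_eq_norm_sq,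
    show P 0 + P 1 + P 2 + P 3 = (4 : ℝ) • centroid P by
      rw [centroid_eq, Complex.real_smul]; push_cast; ring, inner_smul_right]

end Inscribed

/-! ### Products of opposite edges and the gain. -/

/-- A quantitative inequality between the arithmetic and the geometric mean of four squares. -/
theorem prod_le_of_sum_sq {t a b c e : ℝ} (h : a ^ 2 + b ^ 2 + c ^ 2 + e ^ 2 = 4 * t) :
    12 * (a * b * c * e) ≤ 12 * t ^ 2 - ((a ^ 2 - t) ^ 2 + (b ^ 2 - t) ^ 2 + (c ^ 2 - t) ^ 2 +
      (e ^ 2 - t) ^ 2) := by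
  have ht : t = (a ^ 2 + b ^ 2 + c ^ 2 + e ^ 2) / 4 := by linarith
  subst ht
  -- The difference of the two sides is exactly twice the sum of these three squares.
  nlinarith [sq_nonneg (a * b - c * e), sq_nonneg (a * c - b * e), sq_nonneg (a * e - b * c)]

/-- A vector nearly orthogonal to two independent edges is small: `⟪g, p⟫ • q - ⟪g, q⟫ • p` has norm
`‖g‖` times the area spanned by `p` and `q`. -/
theorem norm_mul_orient_sq_le {g u v w : ℂ} (hu : ‖u‖ = 1) (hv : ‖v‖ = 1) (hw : ‖w‖ = 1) :
    ‖g‖ ^ 2 * orient u v w ^ 2 ≤ 8 * (⟪g, v - u⟫ ^ 2 + ⟪g, w - u⟫ ^ 2) := by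
  have hp : ‖v - u‖ ^ 2 ≤ 4 := by
    have := norm_sub_le v u
    rw [hu, hv] at this
    nlinarith [norm_nonneg (v - u)]
  have hq : ‖w - u‖ ^ 2 ≤ 4 := by
    have := norm_sub_le w u
    rw [hu, hw] at this
    nlinarith [norm_nonneg (w - u)]
  rw [orient]
  generalize v - u = p at *
  generalize w - u = q at *
  have e1 : ‖g‖ ^ 2 * (conj p * q).im ^ 2 = ‖⟪g, p⟫ • q - ⟪g, q⟫ • p‖ ^ 2 := by
    simp only [← Complex.normSq_eq_norm_sq, Complex.normSq_apply, Complex.inner, Complex.mul_re,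
      Complex.mul_im, Complex.conj_re, Complex.conj_im, Complex.sub_re, Complex.sub_im,
      Complex.real_smul, Complex.ofReal_re, Complex.ofReal_im]
    ring
  have e2 : ‖⟪g, p⟫ • q - ⟪g, q⟫ • p‖ ^ 2 ≤ 2 * (‖⟪g, p⟫ • q‖ ^ 2 + ‖⟪g, q⟫ • p‖ ^ 2) := by
    have h1 := norm_sub_le (⟪g, p⟫ • q) (⟪g, q⟫ • p)
    nlinarith [norm_nonneg (⟪g, p⟫ • q - ⟪g, q⟫ • p), sq_nonneg (‖⟪g, p⟫ • q‖ - ‖⟪g, q⟫ • p‖)]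
  rw [norm_smul, norm_smul, mul_pow, mul_pow, Real.norm_eq_abs, Real.norm_eq_abs, sq_abs,
    sq_abs] at e2
  rw [e1]
  nlinarith [sq_nonneg ⟪g, p⟫, sq_nonneg ⟪g, q⟫]

/-- The product of the lengths of two opposite edges, for the vertices in the order `σ`. -/
noncomputable def pairProd (σ : Equiv.Perm (Fin 4)) (P : Fin 4 → ℂ) : ℝ :=
  ‖P (σ 0) - P (σ 1)‖ * ‖P (σ 2) - P (σ 3)‖

/-- The common factor by which `step` multiplies the products of opposite edges. -/
noncomputable def gain (P : Fin 4 → ℂ) : ℝ :=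
  (1 - ‖centroid P‖ ^ 2) ^ 2 / ∏ i, ‖P i - centroid P‖

namespace Inscribed

variable {P : Fin 4 → ℂ}

/-- Each vertex occurs once in a pair of opposite edges, so the factor does not depend on `σ`. -/
theorem pairProd_step (h : Inscribed P) (σ : Equiv.Perm (Fin 4)) :
    pairProd σ (CyclicQuad.step P) = pairProd σ P * gain P := by
  have hg := h.norm_centroid_lt_one
  simp only [pairProd, CyclicQuad.step]
  rw [norm_mob_sub_mob (h.norm_eq _) (h.norm_eq _) hg,
    norm_mob_sub_mob (h.norm_eq _) (h.norm_eq _) hg, gain,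
    ← Equiv.prod_comp σ (fun i => ‖P i - centroid P‖), Fin.prod_univ_four, div_mul_div_comm,
    mul_div_assoc']
  congr 1 <;> ring

theorem pairProd_pos (h : Inscribed P) (σ : Equiv.Perm (Fin 4)) : 0 < pairProd σ P := by
  have key : ∀ i j, i ≠ j → 0 < ‖P (σ i) - P (σ j)‖ := fun i j hij =>
    norm_pos_iff.2 (sub_ne_zero.2 fun e => hij (σ.injective (h.injective e)))
  exact mul_pos (key 0 1 (by decide)) (key 2 3 (by decide))

theorem norm_sub_le_two (h : Inscribed P) (i j : Fin 4) : ‖P i - P j‖ ≤ 2 := by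
  have := norm_sub_le (P i) (P j)
  rw [h.norm_eq, h.norm_eq] at this
  linarith

theorem pairProd_le_four (h : Inscribed P) (σ : Equiv.Perm (Fin 4)) : pairProd σ P ≤ 4 := by
  have h1 := h.norm_sub_le_two (σ 0) (σ 1)
  have h2 := h.norm_sub_le_two (σ 2) (σ 3)
  rw [pairProd]
  nlinarith [norm_nonneg (P (σ 0) - P (σ 1)), norm_nonneg (P (σ 2) - P (σ 3))]

/-- The summands are the squared deviations of `‖P i - centroid P‖ ^ 2` from its mean `1 - ‖centroid
P‖ ^ 2`, so this is `prod_le_of_sum_sq` divided by the product. -/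
theorem sum_sq_le_gain (h : Inscribed P) :
    ∑ i, (2 * (‖centroid P‖ ^ 2 - ⟪centroid P, P i⟫)) ^ 2 * gain P ≤ 12 * (gain P - 1) := by
  have hg := h.norm_centroid_lt_one
  have hpos : 0 < ∏ i, ‖P i - centroid P‖ := Finset.prod_pos fun i _ =>
    norm_pos_iff.2 (sub_ne_zero_of_norm_lt (h.norm_eq i) hg)
  have h0 : 0 < 1 - ‖centroid P‖ ^ 2 := by nlinarith [norm_nonneg (centroid P)]
  have h0' : 1 - ‖centroid P‖ ^ 2 ≤ 1 := by nlinarith [norm_nonneg (centroid P)]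
  have e := h.norm_sub_centroid_sq
  have s := sum_inner_centroid (P := P)
  have key := prod_le_of_sum_sq (t := 1 - ‖centroid P‖ ^ 2) (a := ‖P 0 - centroid P‖)
    (b := ‖P 1 - centroid P‖) (c := ‖P 2 - centroid P‖) (e := ‖P 3 - centroid P‖)
    (by rw [e, e, e, e]; linarith)
  rw [e, e, e, e] at key
  simp only [add_sub_cancel_left] at key
  rw [← Finset.sum_mul, gain, Fin.sum_univ_four]
  rw [Fin.prod_univ_four] at hpos ⊢
  rw [mul_div_assoc', div_sub_one hpos.ne', mul_div_assoc']
  refine div_le_div_of_nonneg_right ?_ hpos.le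
  set W := (2 * (‖centroid P‖ ^ 2 - ⟪centroid P, P 0⟫)) ^ 2 +
    (2 * (‖centroid P‖ ^ 2 - ⟪centroid P, P 1⟫)) ^ 2 +
    (2 * (‖centroid P‖ ^ 2 - ⟪centroid P, P 2⟫)) ^ 2 +
    (2 * (‖centroid P‖ ^ 2 - ⟪centroid P, P 3⟫)) ^ 2 with hW
  have hW0 : 0 ≤ W := by positivity
  nlinarith [mul_le_mul_of_nonneg_left (pow_le_one₀ (n := 2) h0.le h0') hW0]

theorem gain_pos (h : Inscribed P) : 0 < gain P := by
  have := h.pairProd_step 1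
  have h1 := h.pairProd_pos 1
  have h2 := h.step.pairProd_pos 1
  rw [this] at h2
  exact (mul_pos_iff_of_pos_left h1).1 h2

theorem one_le_gain (h : Inscribed P) : 1 ≤ gain P := by
  have h1 := h.sum_sq_le_gain
  have h2 : 0 ≤ ∑ i, (2 * (‖centroid P‖ ^ 2 - ⟪centroid P, P i⟫)) ^ 2 * gain P :=
    Finset.sum_nonneg fun i _ => mul_nonneg (sq_nonneg _) h.gain_pos.le
  linarith

theorem norm_centroid_sq_le (h : Inscribed P) :
    ‖centroid P‖ ^ 2 * orient (P 0) (P 1) (P 2) ^ 2 ≤ 96 * (gain P - 1) := by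
  have h1 := h.sum_sq_le_gain
  have h2 := norm_mul_orient_sq_le (g := centroid P) (h.norm_eq 0) (h.norm_eq 1) (h.norm_eq 2)
  have h3 := h.one_le_gain
  rw [inner_sub_right, inner_sub_right] at h2
  rw [← Finset.sum_mul, Fin.sum_univ_four] at h1
  generalize ‖centroid P‖ ^ 2 = s at *
  generalize ⟪centroid P, P 0⟫ = a at *
  generalize ⟪centroid P, P 1⟫ = b at *
  generalize ⟪centroid P, P 2⟫ = c at *
  generalize ⟪centroid P, P 3⟫ = e at *
  have h4 : (2 * (s - a)) ^ 2 + (2 * (s - b)) ^ 2 + (2 * (s - c)) ^ 2 + (2 * (s - e)) ^ 2 ≤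
      12 * (gain P - 1) :=
    (le_mul_of_one_le_right (by positivity) h3).trans h1
  nlinarith [sq_nonneg ((s - a) + (s - b)), sq_nonneg ((s - a) + (s - c)),
    sq_nonneg (s - e), sq_nonneg (s - b), sq_nonneg (s - c)]

end Inscribed

/-! ### First-order motion of the centroid. -/

/-- The mean of the squares of the vertices. -/
noncomputable def meanSq (P : Fin 4 → ℂ) : ℂ := (P 0 ^ 2 + P 1 ^ 2 + P 2 ^ 2 + P 3 ^ 2) / 4

namespace Inscribed

variable {P : Fin 4 → ℂ}

/-- A mean of norm near 1 would need all squares nearly equal. But `P 0 + P 1` and `P 0 + P 2`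
differ by `P 1 - P 2`, so they are not both small, and one of two squares is away from `P 0 ^ 2`. -/
theorem norm_meanSq_sq_le (h : Inscribed P) {δ : ℝ} (hδ : 0 ≤ δ)
    (hP : ∀ i j, i ≠ j → δ ≤ ‖P i - P j‖) : ‖meanSq P‖ ^ 2 ≤ 1 - δ ^ 4 / 32 := by
  have hs : ∀ i, ‖P i ^ 2‖ = 1 := fun i => by rw [norm_pow, h.norm_eq, one_pow]
  have h1 := norm_sum_sq (hs 0) (hs 1) (hs 2) (hs 3)
  have hd : ∀ i j, i ≠ j → δ ^ 2 * ‖P i + P j‖ ^ 2 ≤ ‖P i ^ 2 - P j ^ 2‖ ^ 2 := by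
    intro i j hij
    rw [sq_sub_sq, norm_mul, mul_pow, mul_comm]
    gcongr
    exact hP i j hij
  have e1 := hd 0 1 (by decide)
  have e2 := hd 0 2 (by decide)
  have e3 : δ ^ 2 ≤ 2 * (‖P 0 + P 1‖ ^ 2 + ‖P 0 + P 2‖ ^ 2) := by
    have h2 := norm_sub_le (P 0 + P 1) (P 0 + P 2)
    rw [add_sub_add_left_eq_sub] at h2
    have h3 := hP 1 2 (by decide)
    nlinarith [sq_nonneg (‖P 0 + P 1‖ - ‖P 0 + P 2‖), norm_nonneg (P 0 + P 1),
      norm_nonneg (P 0 + P 2)]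
  have e4 := mul_le_mul_of_nonneg_left e3 (sq_nonneg δ)
  rw [meanSq, norm_div, Complex.norm_ofNat, div_pow, h1]
  nlinarith [sq_nonneg ‖P 0 ^ 2 - P 3 ^ 2‖, sq_nonneg ‖P 1 ^ 2 - P 2 ^ 2‖,
    sq_nonneg ‖P 1 ^ 2 - P 3 ^ 2‖, sq_nonneg ‖P 2 ^ 2 - P 3 ^ 2‖]

theorem norm_centroid_step_sub_le (h : Inscribed P) (hg : ‖centroid P‖ ≤ 1 / 2) :
    ‖centroid (CyclicQuad.step P) - conj (centroid P) * meanSq P‖ ≤ 4 * ‖centroid P‖ ^ 2 := by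
  have e := fun i => norm_mob_sub_le (h.norm_eq i) hg
  set f : Fin 4 → ℂ := fun i =>
    mob (centroid P) (P i) - (P i + conj (centroid P) * P i ^ 2 - centroid P) with hf
  have h1 : centroid (CyclicQuad.step P) - conj (centroid P) * meanSq P =
      (f 0 + f 1 + f 2 + f 3) / 4 := by
    have h2 : P 0 + P 1 + P 2 + P 3 = 4 * centroid P := by rw [centroid_eq]; ring
    rw [centroid_eq (CyclicQuad.step P), meanSq]
    simp only [CyclicQuad.step, hf]
    linear_combination h2 / 4
  rw [h1, norm_div, Complex.norm_ofNat, div_le_iff₀ (by norm_num)]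
  have e0 := norm_add_le (f 0 + f 1 + f 2) (f 3)
  have e' := norm_add₃_le (a := f 0) (b := f 1) (c := f 2)
  linarith [e 0, e 1, e 2, e 3]

theorem dist_step_le (h : Inscribed P) (hg : ‖centroid P‖ ≤ 1 / 2) :
    dist P (CyclicQuad.step P) ≤ 4 * ‖centroid P‖ := by
  rw [dist_comm, dist_pi_le_iff (by positivity)]
  intro i
  rw [dist_eq_norm]
  exact norm_mob_sub_self_le (h.norm_eq i) hg

end Inscribed

end CyclicQuad

/-! ### Iteration: convexity, separation, vanishing of the centroid. -/

namespace CyclicQuad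

open Complex ComplexConjugate Filter Asymptotics Topology

theorem isConvexQuad_iff {P : Fin 4 → ℂ} (h : Function.Injective P) : IsConvexQuad P ↔
    ∀ i, 0 < orient (P i) (P (i + 1)) (P (i + 2)) * orient (P i) (P (i + 1)) (P (i + 3)) :=
  forall_congr' fun i => sSameSide_iff_orient fun e => by
    have := h e
    revert this
    fin_cases i <;> decide

theorem IsConvexQuad.neg {P : Fin 4 → ℂ} (hP : Function.Injective P) (h : IsConvexQuad P) :
    IsConvexQuad (-P) := by
  rw [isConvexQuad_iff hP] at h
  rw [isConvexQuad_iff (P := -P) fun i j e => hP (neg_injective e)]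
  simpa only [Pi.neg_apply, orient_neg] using h

namespace Inscribed

variable {P : Fin 4 → ℂ}

theorem isConvexQuad_step (h : Inscribed P) (hc : IsConvexQuad P) :
    IsConvexQuad (CyclicQuad.step P) := by
  rw [isConvexQuad_iff h.step.injective]
  rw [isConvexQuad_iff h.injective] at hc
  intro i
  have hg := h.norm_centroid_lt_one
  have hs : 0 < 1 - ‖centroid P‖ ^ 2 := by nlinarith [norm_nonneg (centroid P)]
  have hr : ∀ i, 0 < ‖P i - centroid P‖ := fun i =>
    norm_pos_iff.2 (sub_ne_zero_of_norm_lt (h.norm_eq i) hg)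
  have h0 := hr i
  have h1 := hr (i + 1)
  have h2 := hr (i + 2)
  have h3 := hr (i + 3)
  simp only [CyclicQuad.step]
  rw [orient_mob (h.norm_eq _) (h.norm_eq _) (h.norm_eq _) hg,
    orient_mob (h.norm_eq _) (h.norm_eq _) (h.norm_eq _) hg, mul_mul_mul_comm]
  exact mul_pos (hc i) (by positivity)

theorem isConvexQuad_iterate (h : Inscribed P) (hc : IsConvexQuad P) (n : ℕ) :
    IsConvexQuad (CyclicQuad.step^[n] P) := by
  induction n with
  | zero => exact hc
  | succ n ih =>
    rw [Function.iterate_succ_apply']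
    exact (h.iterate n).isConvexQuad_step ih

theorem pairProd_iterate_succ (h : Inscribed P) (σ : Equiv.Perm (Fin 4)) (n : ℕ) :
    pairProd σ (CyclicQuad.step^[n + 1] P) =
      pairProd σ (CyclicQuad.step^[n] P) * gain (CyclicQuad.step^[n] P) := by
  rw [Function.iterate_succ_apply', (h.iterate n).pairProd_step]

theorem monotone_pairProd (h : Inscribed P) (σ : Equiv.Perm (Fin 4)) :
    Monotone fun n => pairProd σ (CyclicQuad.step^[n] P) :=
  monotone_nat_of_le_succ fun n => by
    rw [h.pairProd_iterate_succ]
    exact le_mul_of_one_le_right ((h.iterate n).pairProd_pos σ).le (h.iterate n).one_le_gain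

theorem exists_separation (h : Inscribed P) : ∃ δ : ℝ, 0 < δ ∧ ∀ n i j, i ≠ j →
    δ ≤ ‖CyclicQuad.step^[n] P i - CyclicQuad.step^[n] P j‖ := by
  obtain ⟨σ, -, hσ⟩ := Finset.exists_min_image Finset.univ (fun σ => pairProd σ P) ⟨1, by simp⟩
  -- The product never drops below its initial minimum, and the opposite edge has length at most 2.
  refine ⟨pairProd σ P / 2, half_pos (h.pairProd_pos σ), fun n i j hij => ?_⟩
  obtain ⟨τ, rfl, rfl⟩ : ∃ τ : Equiv.Perm (Fin 4), τ 0 = i ∧ τ 1 = j := by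
    revert i j; decide
  have h1 := h.monotone_pairProd τ (Nat.zero_le n)
  have h2 := hσ τ (Finset.mem_univ _)
  have h3 := (h.iterate n).norm_sub_le_two (τ 2) (τ 3)
  simp only [Function.iterate_zero, id_eq] at h1
  have h4 := h2.trans h1
  rw [pairProd.eq_def τ] at h4
  nlinarith [norm_nonneg (CyclicQuad.step^[n] P (τ 0) - CyclicQuad.step^[n] P (τ 1))]

theorem tendsto_norm_centroid (h : Inscribed P) :
    Tendsto (fun n => ‖centroid (CyclicQuad.step^[n] P)‖) atTop (𝓝 0) := by
  obtain ⟨δ, hδ, hsep⟩ := h.exists_separation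
  set m : ℕ → ℝ := fun n => pairProd 1 (CyclicQuad.step^[n] P) with hm
  have hmono : Monotone m := h.monotone_pairProd 1
  have hm0 : 0 < m 0 := h.pairProd_pos 1
  have hlim := tendsto_atTop_ciSup hmono ⟨4, by
    rintro _ ⟨n, rfl⟩; exact (h.iterate n).pairProd_le_four 1⟩
  -- Here `384 = 4 * 96`: 96 comes from `norm_centroid_sq_le`, 4 from `orient_sq`.
  have hdiff : Tendsto (fun n => 384 / (δ ^ 6 * m 0) * (m (n + 1) - m n)) atTop (𝓝 0) := by
    have := ((hlim.comp (tendsto_add_atTop_nat 1)).sub hlim).const_mul (384 / (δ ^ 6 * m 0))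
    simpa using this
  have hsq : Tendsto (fun n => ‖centroid (CyclicQuad.step^[n] P)‖ ^ 2) atTop (𝓝 0) := by
    refine squeeze_zero (fun n => sq_nonneg _) (fun n => ?_) hdiff
    have hn := h.iterate n
    have h1 := hn.norm_centroid_sq_le
    have h2 := orient_sq (hn.norm_eq 0) (hn.norm_eq 1) (hn.norm_eq 2)
    have h3 : m (n + 1) = m n * gain _ := h.pairProd_iterate_succ 1 n
    have h4 : m 0 ≤ m n := hmono (Nat.zero_le n)
    have h5 : δ ^ 6 ≤ 4 * orient (CyclicQuad.step^[n] P 0) (CyclicQuad.step^[n] P 1)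
        (CyclicQuad.step^[n] P 2) ^ 2 := by
      rw [h2, show δ ^ 6 = δ ^ 2 * δ ^ 2 * δ ^ 2 by ring]
      gcongr <;> exact hsep n _ _ (by decide)
    rw [div_mul_eq_mul_div, le_div_iff₀ (by positivity), h3]
    have hx0 := sq_nonneg ‖centroid (CyclicQuad.step^[n] P)‖
    generalize ‖centroid (CyclicQuad.step^[n] P)‖ ^ 2 = x at *
    have h6 := hn.one_le_gain
    calc x * (δ ^ 6 * m 0) ≤ x * (4 * orient (CyclicQuad.step^[n] P 0) (CyclicQuad.step^[n] P 1)
          (CyclicQuad.step^[n] P 2) ^ 2) * m 0 := by rw [← mul_assoc]; gcongr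
      _ ≤ 384 * (gain (CyclicQuad.step^[n] P) - 1) * m 0 :=
        mul_le_mul_of_nonneg_right (by linarith) hm0.le
      _ ≤ 384 * (gain (CyclicQuad.step^[n] P) - 1) * m n :=
        mul_le_mul_of_nonneg_left h4 (by linarith)
      _ = _ := by ring
  have := hsq.sqrt
  simpa using this

end Inscribed

/-! ### Geometric decay and convergence. -/

theorem isBigO_pow_of_le_mul {x : ℕ → ℝ} {p : ℝ} (hx : ∀ n, 0 ≤ x n) (hp : 0 < p)
    (h : ∀ᶠ n in atTop, x (n + 1) ≤ p * x n) : x =O[atTop] fun n => p ^ n := by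
  obtain ⟨N, hN⟩ := eventually_atTop.1 h
  refine IsBigO.of_bound (x N / p ^ N) (eventually_atTop.2 ⟨N, fun n hn => ?_⟩)
  rw [Real.norm_of_nonneg (hx n), Real.norm_of_nonneg (by positivity)]
  induction n, hn using Nat.le_induction with
  | base => rw [div_mul_cancel₀ _ (by positivity)]
  | succ n hn ih =>
    refine (hN n hn).trans ?_
    rw [pow_succ]
    nlinarith

section Metric

variable {X : Type*} [PseudoMetricSpace X] {u : ℕ → X} {p : ℝ}

theorem exists_dist_le_of_isBigO (hp : 0 < p)
    (h : (fun n => dist (u n) (u (n + 1))) =O[atTop] fun n => p ^ n) :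
    ∃ C, ∀ n, dist (u n) (u (n + 1)) ≤ C * p ^ n := by
  obtain ⟨C, hC⟩ := (isBigO_nat_atTop_iff fun n hn => absurd hn (by positivity)).1 h
  refine ⟨C, fun n => ?_⟩
  have := hC n
  rwa [Real.norm_of_nonneg dist_nonneg, Real.norm_of_nonneg (by positivity)] at this

theorem cauchySeq_of_isBigO_pow (hp : 0 < p) (hp1 : p < 1)
    (h : (fun n => dist (u n) (u (n + 1))) =O[atTop] fun n => p ^ n) : CauchySeq u := by
  obtain ⟨C, hC⟩ := exists_dist_le_of_isBigO hp h
  exact cauchySeq_of_le_geometric p C hp1 hC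

theorem isBigO_dist_of_isBigO_pow (hp : 0 < p) (hp1 : p < 1)
    (h : (fun n => dist (u n) (u (n + 1))) =O[atTop] fun n => p ^ n) {a : X}
    (ha : Tendsto u atTop (𝓝 a)) : (fun n => dist (u n) a) =O[atTop] fun n => p ^ n := by
  obtain ⟨C, hC⟩ := exists_dist_le_of_isBigO hp h
  refine IsBigO.of_bound (C / (1 - p)) (Eventually.of_forall fun n => ?_)
  rw [Real.norm_of_nonneg dist_nonneg, Real.norm_of_nonneg (by positivity)]
  have := dist_le_of_le_geometric_of_tendsto p C hp1 hC ha n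
  rwa [mul_div_right_comm] at this

end Metric

theorem continuous_centroid : Continuous centroid := by
  simp only [funext centroid_eq]; fun_prop

theorem continuous_meanSq : Continuous meanSq := by
  unfold meanSq; fun_prop

theorem continuous_pairProd (σ : Equiv.Perm (Fin 4)) : Continuous (pairProd σ) := by
  unfold pairProd; fun_prop

theorem continuous_orient (i j k : Fin 4) :
    Continuous fun P : Fin 4 → ℂ => orient (P i) (P j) (P k) := by
  simp only [orient]
  exact Complex.continuous_im.comp
    ((Complex.continuous_conj.comp (by fun_prop)).mul (by fun_prop))

namespace Inscribed

variable {P E : Fin 4 → ℂ}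

theorem eventually_norm_centroid_le (h : Inscribed P) {ε : ℝ} (hε : 0 < ε) :
    ∀ᶠ n in atTop, ‖centroid (CyclicQuad.step^[n] P)‖ ≤ ε :=
  (h.tendsto_norm_centroid.eventually (gt_mem_nhds hε)).mono fun _ => le_of_lt

theorem norm_centroid_iterate_succ (h : Inscribed P) : ∀ᶠ n in atTop,
    |‖centroid (CyclicQuad.step^[n + 1] P)‖ -
      ‖meanSq (CyclicQuad.step^[n] P)‖ * ‖centroid (CyclicQuad.step^[n] P)‖| ≤
      4 * ‖centroid (CyclicQuad.step^[n] P)‖ ^ 2 := by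
  filter_upwards [h.eventually_norm_centroid_le (ε := 1 / 2) (by norm_num)] with n hn
  rw [Function.iterate_succ_apply', mul_comm, ← Complex.norm_conj (centroid _),
    ← Complex.norm_conj (centroid (CyclicQuad.step^[n] P)), ← norm_mul]
  rw [Complex.norm_conj, Complex.norm_conj]
  exact (abs_norm_sub_norm_le _ _).trans ((h.iterate n).norm_centroid_step_sub_le hn)

theorem isBigO_dist_iterate_succ (h : Inscribed P) {p r : ℝ} (hp : 0 < p) (hr : r < p)
    (hm : ∀ᶠ n in atTop, ‖meanSq (CyclicQuad.step^[n] P)‖ ≤ r) :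
    (fun n => dist (CyclicQuad.step^[n] P) (CyclicQuad.step^[n + 1] P)) =O[atTop]
      fun n => p ^ n := by
  have h1 : (fun n => ‖centroid (CyclicQuad.step^[n] P)‖) =O[atTop] fun n => p ^ n := by
    refine isBigO_pow_of_le_mul (fun n => norm_nonneg _) hp ?_
    filter_upwards [h.norm_centroid_iterate_succ, hm,
      -- With this bound the quadratic error `4 * ‖g‖ ^ 2` costs at most `(p - r) * ‖g‖`.
      h.eventually_norm_centroid_le (ε := (p - r) / 4) (by linarith)] with n h1 h2 h3
    have h4 := (abs_le.1 h1).2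
    nlinarith [norm_nonneg (centroid (CyclicQuad.step^[n] P))]
  refine IsBigO.trans (IsBigO.of_bound 4 ?_) h1
  filter_upwards [h.eventually_norm_centroid_le (ε := 1 / 2) (by norm_num)] with n hn
  rw [Real.norm_of_nonneg dist_nonneg, norm_norm, Function.iterate_succ_apply']
  exact (h.iterate n).dist_step_le hn

theorem exists_tendsto_iterate (h : Inscribed P) :
    ∃ E, Tendsto (fun n => CyclicQuad.step^[n] P) atTop (𝓝 E) := by
  obtain ⟨δ, hδ, hsep⟩ := h.exists_separation
  set r := √(1 - δ ^ 4 / 32) with hr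
  have hr1 : r < 1 := by
    rw [hr, Real.sqrt_lt' one_pos]
    have := pow_pos hδ 4
    linarith
  have hr0 : 0 ≤ r := Real.sqrt_nonneg _
  have hm : ∀ n, ‖meanSq (CyclicQuad.step^[n] P)‖ ≤ r := fun n =>
    Real.le_sqrt_of_sq_le ((h.iterate n).norm_meanSq_sq_le hδ.le (hsep n))
  have h1 := h.isBigO_dist_iterate_succ (p := (r + 1) / 2) (r := r) (by linarith) (by linarith)
    (Eventually.of_forall hm)
  exact cauchySeq_tendsto_of_complete
    (cauchySeq_of_isBigO_pow (by linarith) (by linarith) h1)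

theorem isBigO_dist_iterate_limit (h : Inscribed P)
    (hE : Tendsto (fun n => CyclicQuad.step^[n] P) atTop (𝓝 E)) {p : ℝ} (hp : ‖meanSq E‖ < p)
    (hp1 : p < 1) :
    (fun n => dist (CyclicQuad.step^[n] P) E) =O[atTop] fun n => p ^ n := by
  have hp0 : 0 < p := (norm_nonneg _).trans_lt hp
  have h1 : Tendsto (fun n => ‖meanSq (CyclicQuad.step^[n] P)‖) atTop (𝓝 ‖meanSq E‖) :=
    ((continuous_meanSq.tendsto E).comp hE).norm
  obtain ⟨r, hr, hrp⟩ := exists_between hp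
  exact isBigO_dist_of_isBigO_pow hp0 hp1 (h.isBigO_dist_iterate_succ hp0 hrp
    ((h1.eventually (gt_mem_nhds hr)).mono fun _ => le_of_lt)) hE

/-! ### The limit quadrilateral. -/

theorem limit (h : Inscribed P)
    (hE : Tendsto (fun n => CyclicQuad.step^[n] P) atTop (𝓝 E)) : Inscribed E := by
  obtain ⟨δ, hδ, hsep⟩ := h.exists_separation
  rw [tendsto_pi_nhds] at hE
  refine ⟨fun i => ?_, fun i j hij => ?_⟩
  · exact tendsto_nhds_unique (hE i).norm
      (tendsto_const_nhds.congr fun n => ((h.iterate n).norm_eq i).symm)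
  · by_contra hne
    have := ge_of_tendsto' ((hE i).sub (hE j)).norm fun n => hsep n i j hne
    rw [hij, sub_self, norm_zero] at this
    exact hδ.not_ge this

theorem centroid_limit (h : Inscribed P)
    (hE : Tendsto (fun n => CyclicQuad.step^[n] P) atTop (𝓝 E)) : centroid E = 0 :=
  norm_eq_zero.1 <| tendsto_nhds_unique ((continuous_centroid.tendsto E).comp hE).norm
    h.tendsto_norm_centroid

theorem pairProd_limit (h : Inscribed P)
    (hE : Tendsto (fun n => CyclicQuad.step^[n] P) atTop (𝓝 E)) (σ τ : Equiv.Perm (Fin 4)) :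
    pairProd σ E * pairProd τ P = pairProd τ E * pairProd σ P := by
  have h1 : ∀ n, pairProd σ (CyclicQuad.step^[n] P) * pairProd τ P =
      pairProd τ (CyclicQuad.step^[n] P) * pairProd σ P := by
    intro n
    induction n with
    | zero => exact mul_comm _ _
    | succ n ih =>
      rw [h.pairProd_iterate_succ, h.pairProd_iterate_succ]
      linear_combination gain (CyclicQuad.step^[n] P) * ih
  exact tendsto_nhds_unique ((((continuous_pairProd σ).tendsto E).comp hE).mul_const _)
    (((((continuous_pairProd τ).tendsto E).comp hE).mul_const _).congr fun n => (h1 n).symm)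

theorem orient_limit (h : Inscribed P) (hc : IsConvexQuad P)
    (hE : Tendsto (fun n => CyclicQuad.step^[n] P) atTop (𝓝 E)) (i : Fin 4) :
    0 ≤ orient (E i) (E (i + 1)) (E (i + 2)) * orient (E i) (E (i + 1)) (E (i + 3)) :=
  ge_of_tendsto' ((((continuous_orient _ _ _).tendsto E).comp hE).mul
    (((continuous_orient _ _ _).tendsto E).comp hE)) fun n =>
      ((isConvexQuad_iff (h.iterate n).injective).1 (h.isConvexQuad_iterate hc n) i).le

theorem orient_mul_orient_neg (h : Inscribed E)
    {i j k l : Fin 4} (hij : E j = -E i) (hkl : E l = -E k) (hik : i ≠ k) (hjk : j ≠ k)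
    (hl : i ≠ j) : orient (E i) (E j) (E k) * orient (E i) (E j) (E l) < 0 := by
  have h1 : orient (E i) (E j) (E l) = -orient (E i) (E j) (E k) := by
    rw [hij, hkl]
    simp only [orient, Complex.mul_im, Complex.conj_re, Complex.conj_im, Complex.sub_re,
      Complex.sub_im, Complex.neg_re, Complex.neg_im]
    ring
  have h2 := orient_sq (h.norm_eq i) (h.norm_eq j) (h.norm_eq k)
  have h3 : ∀ {a b}, a ≠ b → 0 < ‖E a - E b‖ := fun hab =>
    norm_pos_iff.2 (sub_ne_zero.2 fun e => hab (h.injective e))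
  have a1 := h3 hl
  have a2 := h3 hjk
  have a3 := h3 hik
  have : 0 < 4 * orient (E i) (E j) (E k) ^ 2 := by rw [h2]; positivity
  rw [h1]
  nlinarith

/-- Conjugating the zero sum shows that the inverses also sum to zero, so the first and third
elementary symmetric functions vanish and `E 0` has an antipode among the vertices. An antipodal
side would separate the other two vertices, so even the weak convexity that survives in the limit
rules it out. -/
theorem antipodal (h : Inscribed E) (h0 : centroid E = 0)
    (hc : ∀ i, 0 ≤ orient (E i) (E (i + 1)) (E (i + 2)) * orient (E i) (E (i + 1)) (E (i + 3))) :
    E 2 = -E 0 ∧ E 3 = -E 1 := by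
  have e1 : E 0 + E 1 + E 2 + E 3 = 0 := by
    rw [centroid_eq] at h0; linear_combination 4 * h0
  have n0 := ne_zero_of_norm_eq_one (h.norm_eq 0)
  have n1 := ne_zero_of_norm_eq_one (h.norm_eq 1)
  have n2 := ne_zero_of_norm_eq_one (h.norm_eq 2)
  have n3 := ne_zero_of_norm_eq_one (h.norm_eq 3)
  have e3 : (E 0)⁻¹ + (E 1)⁻¹ + (E 2)⁻¹ + (E 3)⁻¹ = 0 := by
    have := congrArg conj e1
    simpa only [map_add, conj_eq_inv (h.norm_eq _), map_zero] using this
  have e3' : E 1 * E 2 * E 3 + E 0 * E 2 * E 3 + E 0 * E 1 * E 3 + E 0 * E 1 * E 2 = 0 := by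
    field_simp at e3
    linear_combination e3
  have e : (E 0 + E 1) * (E 0 + E 2) * (E 0 + E 3) = 0 := by
    linear_combination E 0 ^ 2 * e1 + e3'
  rcases mul_eq_zero.1 e with e | e
  · rcases mul_eq_zero.1 e with e | e
    · have := h.orient_mul_orient_neg (i := 0) (j := 1) (k := 2) (l := 3) (by linear_combination e)
        (by linear_combination e1 - e) (by decide) (by decide) (by decide)
      exact absurd (hc 0) this.not_ge
    · exact ⟨by linear_combination e, by linear_combination e1 - e⟩
  · have := h.orient_mul_orient_neg (i := 3) (j := 0) (k := 1) (l := 2) (by linear_combination e)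
      (by linear_combination e1 - e) (by decide) (by decide) (by decide)
    exact absurd (hc 3) this.not_ge

end Inscribed

end CyclicQuad

/-! ### The original sequence and its rates of convergence. -/

namespace CyclicQuad

open Complex ComplexConjugate Filter Asymptotics Topology

namespace Inscribed

variable {P E : Fin 4 → ℂ}

theorem neg (h : Inscribed P) : Inscribed (-P) :=
  ⟨fun i => by rw [Pi.neg_apply, norm_neg, h.norm_eq], fun _ _ e => h.injective (neg_injective e)⟩

theorem next_eq (h : Inscribed P) : next P = -CyclicQuad.step P := by
  funext i
  exact secondInter_eq (h.norm_eq i) h.norm_centroid_lt_one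

theorem seq_eq (h : Inscribed P) (n : ℕ) :
    (Even n → seq P n = CyclicQuad.step^[n] P) ∧ (Odd n → seq P n = -CyclicQuad.step^[n] P) := by
  induction n with
  | zero => exact ⟨fun _ => rfl, fun h => absurd h (by decide)⟩
  | succ n ih =>
    rw [seq, Function.iterate_succ_apply', Function.iterate_succ_apply', ← seq]
    refine ⟨fun hn => ?_, fun hn => ?_⟩
    · rw [ih.2 (by simpa [Nat.even_add_one] using hn), (h.iterate n).neg.next_eq, step_neg, neg_neg]
    · rw [ih.1 (by simpa [Nat.odd_add_one] using hn), (h.iterate n).next_eq]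

theorem seq_even (h : Inscribed P) (i : ℕ) : seq P (2 * i) = CyclicQuad.step^[2 * i] P :=
  (h.seq_eq _).1 (even_two_mul i)

theorem seq_odd (h : Inscribed P) (i : ℕ) : seq P (2 * i + 1) = -CyclicQuad.step^[2 * i + 1] P :=
  (h.seq_eq _).2 (odd_two_mul_add_one i)

theorem OG_eq (h : Inscribed P) (n : ℕ) : OG P n = ‖centroid (CyclicQuad.step^[n] P)‖ := by
  rw [OG, dist_zero_left]
  rcases n.even_or_odd with hn | hn
  · rw [(h.seq_eq n).1 hn]
  · rw [(h.seq_eq n).2 hn, centroid_neg, norm_neg]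

theorem seq (h : Inscribed P) (n : ℕ) : Inscribed (seq P n) := by
  rcases n.even_or_odd with hn | hn
  · rw [(h.seq_eq n).1 hn]; exact h.iterate n
  · rw [(h.seq_eq n).2 hn]; exact (h.iterate n).neg

theorem isConvexQuad_seq (h : Inscribed P) (hc : IsConvexQuad P) (n : ℕ) :
    IsConvexQuad (CyclicQuad.seq P n) := by
  rcases n.even_or_odd with hn | hn
  · rw [(h.seq_eq n).1 hn]; exact h.isConvexQuad_iterate hc n
  · rw [(h.seq_eq n).2 hn]; exact (h.isConvexQuad_iterate hc n).neg (h.iterate n).injective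

theorem norm_add_sq_add (h : Inscribed P) (i j : Fin 4) :
    ‖P i + P j‖ ^ 2 = 4 - ‖P i - P j‖ ^ 2 := by
  rw [norm_add_sq_real, norm_sub_sq_real, h.norm_eq, h.norm_eq]; ring

theorem isRectangle (h : Inscribed E) (h2 : E 2 = -E 0) (h3 : E 3 = -E 1) : IsRectangle E where
  injective := h.injective
  parallelogram := by rw [h2, h3]; ring
  right_angle := by
    rw [h3, show -E 1 - E 0 = -(E 1 + E 0) by ring, inner_neg_right, real_inner_comm,
      real_inner_add_sub_eq_zero_iff _ _ |>.2, neg_zero]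
    rw [h.norm_eq, h.norm_eq]

theorem d_diagonal (h : Inscribed E) (h2 : E 2 = -E 0) : d E 0 2 = 4 := by
  rw [d, dist_eq_norm, h2, sub_neg_eq_add, h.norm_add_sq_add, sub_self, norm_zero]; norm_num

theorem d_edges (h : Inscribed E) (h3 : E 3 = -E 1) : d E 0 3 = 4 - d E 0 1 := by
  rw [d, d, dist_eq_norm, dist_eq_norm, h3, sub_neg_eq_add, h.norm_add_sq_add]

theorem norm_meanSq (h : Inscribed E) (h2 : E 2 = -E 0) (h3 : E 3 = -E 1) :
    ‖meanSq E‖ = |d E 0 1 - 2| / 2 := by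
  have e1 : d E 0 1 - 2 = -(2 * ⟪E 0, E 1⟫) := by
    rw [d, dist_eq_norm, norm_sub_sq_real, h.norm_eq, h.norm_eq]; ring
  have e2 : ((⟪E 0, E 1⟫ : ℝ) : ℂ) = (conj (E 0) * E 1 + E 0 * conj (E 1)) / 2 := by
    rw [Complex.inner, Complex.re_eq_add_conj]
    simp [mul_comm]
  -- By antipodality the mean is `(E 0 ^ 2 + E 1 ^ 2) / 2`; a unimodular factor comes out.
  have e3 : meanSq E = (⟪E 0, E 1⟫ : ℝ) * (E 0 * E 1) := by
    rw [e2, meanSq, h2, h3]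
    linear_combination (-(E 1 ^ 2) / 2) * mul_conj_eq_one (h.norm_eq 0) -
      (E 0 ^ 2 / 2) * mul_conj_eq_one (h.norm_eq 1)
  rw [e3, e1, norm_mul, norm_mul, h.norm_eq, h.norm_eq, Complex.norm_real, Real.norm_eq_abs,
    abs_neg, abs_mul, abs_two]
  ring

theorem isSquareQuad_iff (h : Inscribed E) (h2 : E 2 = -E 0) (h3 : E 3 = -E 1) :
    IsSquareQuad E ↔ meanSq E = 0 := by
  have e : dist (E 0) (E 1) = dist (E 1) (E 2) ↔ d E 0 1 = 2 := by
    rw [← sq_eq_sq₀ dist_nonneg dist_nonneg, d, dist_eq_norm, dist_eq_norm, h2, sub_neg_eq_add,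
      add_comm, h.norm_add_sq_add]
    constructor <;> intro _ <;> linarith
  rw [← norm_eq_zero, h.norm_meanSq h2 h3, div_eq_zero_iff, abs_eq_zero, sub_eq_zero]
  constructor
  · intro hs
    exact .inl (e.1 hs.adjacent_sides)
  · rintro (hs | hs)
    · exact ⟨h.isRectangle h2 h3, e.2 hs⟩
    · norm_num at hs

theorem norm_meanSq_lt_one (h : Inscribed E) (h2 : E 2 = -E 0) (h3 : E 3 = -E 1) :
    ‖meanSq E‖ < 1 := by
  have hd : ∀ i j, i ≠ j → 0 < d E i j := fun i j hij =>
    pow_pos (dist_pos.2 fun e => hij (h.injective e)) 2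
  have a1 := hd 0 1 (by decide)
  have a2 := hd 0 3 (by decide)
  rw [h.d_edges h3] at a2
  rw [h.norm_meanSq h2 h3, div_lt_one two_pos, abs_lt]
  constructor <;> linarith

theorem d_neg (i j : Fin 4) : d (-E) i j = d E i j := by
  rw [d, d, Pi.neg_apply, Pi.neg_apply, dist_neg_neg]

theorem isLimitForm (h : Inscribed E) (h0 : centroid E = 0) (h2 : E 2 = -E 0) (h3 : E 3 = -E 1)
    (h01 : d E 0 1 = 4 * (√(d P 0 1 * d P 2 3) / √(d P 0 2 * d P 1 3))) : IsLimitForm P E where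
  toIsRectangle := h.isRectangle h2 h3
  centroid_eq := h0
  d13 := h.d_diagonal h2
  d12 := h01
  d14 := h.d_edges h3

theorem d_limit (h : Inscribed P) (hE : Tendsto (fun n => CyclicQuad.step^[n] P) atTop (𝓝 E))
    (h2 : E 2 = -E 0) (h3 : E 3 = -E 1) :
    d E 0 1 = 4 * (√(d P 0 1 * d P 2 3) / √(d P 0 2 * d P 1 3)) := by
  -- The identity picks two opposite sides, the swap the two diagonals, both of length 2 in the
  -- limit.
  have key := h.pairProd_limit hE 1 (Equiv.swap 1 2)
  have hpos := h.pairProd_pos (Equiv.swap 1 2)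
  have hiE := h.limit hE
  have s0 : Equiv.swap (1 : Fin 4) 2 0 = 0 := by decide
  have s1 : Equiv.swap (1 : Fin 4) 2 1 = 2 := by decide
  have s2 : Equiv.swap (1 : Fin 4) 2 2 = 1 := by decide
  have s3 : Equiv.swap (1 : Fin 4) 2 3 = 3 := by decide
  simp only [pairProd, Equiv.Perm.one_apply, s0, s1, s2, s3] at key hpos
  have e1 : ‖E 2 - E 3‖ = ‖E 0 - E 1‖ := by rw [h2, h3, ← norm_neg]; congr 1; ring
  have e2 : ‖E 0 - E 2‖ = 2 := by
    rw [h2, sub_neg_eq_add, ← two_mul, norm_mul, hiE.norm_eq, Complex.norm_ofNat, mul_one]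
  have e3 : ‖E 1 - E 3‖ = 2 := by
    rw [h3, sub_neg_eq_add, ← two_mul, norm_mul, hiE.norm_eq, Complex.norm_ofNat, mul_one]
  rw [e1, e2, e3] at key
  simp only [d, ← mul_pow, dist_eq_norm]
  rw [Real.sqrt_sq (by positivity), Real.sqrt_sq (by positivity), mul_div_assoc', eq_div_iff hpos.ne']
  linear_combination key

theorem OG_isEquivalent (h : Inscribed P)
    (hE : Tendsto (fun n => CyclicQuad.step^[n] P) atTop (𝓝 E)) (hm : meanSq E ≠ 0) :
    (fun n => OG P (n + 1)) ~[atTop] fun n => ‖meanSq E‖ * OG P n := by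
  have hm' : 0 < ‖meanSq E‖ := norm_pos_iff.2 hm
  have h1 : Tendsto (fun n => |‖meanSq (CyclicQuad.step^[n] P)‖ - ‖meanSq E‖|) atTop (𝓝 0) := by
    have := (((continuous_meanSq.tendsto E).comp hE).norm.sub_const ‖meanSq E‖).abs
    simpa using this
  refine isLittleO_iff.2 fun c hc => ?_
  have hc' : 0 < c * ‖meanSq E‖ := mul_pos hc hm'
  filter_upwards [h.norm_centroid_iterate_succ, h1.eventually (gt_mem_nhds (half_pos hc')),
    h.eventually_norm_centroid_le (ε := c * ‖meanSq E‖ / 8) (by linarith)] with n a1 a2 a3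
  simp only [Pi.sub_apply, h.OG_eq]
  rw [Real.norm_eq_abs, norm_mul, norm_norm, norm_norm]
  have hx := norm_nonneg (centroid (CyclicQuad.step^[n] P))
  generalize ‖centroid (CyclicQuad.step^[n] P)‖ = x at *
  generalize ‖centroid (CyclicQuad.step^[n + 1] P)‖ = y at *
  generalize ‖meanSq (CyclicQuad.step^[n] P)‖ = μ at *
  have e : y - ‖meanSq E‖ * x = (y - μ * x) + (μ - ‖meanSq E‖) * x := by ring
  rw [e]
  refine (abs_add_le _ _).trans ?_
  rw [abs_mul, abs_of_nonneg hx]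
  nlinarith

theorem norm_meanSq_sub_le (hP : Inscribed P) (hE : Inscribed E) :
    ‖meanSq P - meanSq E‖ ≤ 2 * dist P E := by
  have key : ∀ i, ‖P i ^ 2 - E i ^ 2‖ ≤ 2 * dist P E := by
    intro i
    have h1 := norm_add_le (P i) (E i)
    rw [hP.norm_eq, hE.norm_eq] at h1
    have h2 := dist_le_pi_dist P E i
    rw [dist_eq_norm] at h2
    rw [sq_sub_sq, norm_mul]
    exact mul_le_mul (by linarith) h2 (norm_nonneg _) zero_le_two
  have e : meanSq P - meanSq E = ((P 0 ^ 2 - E 0 ^ 2) + (P 1 ^ 2 - E 1 ^ 2) +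
      (P 2 ^ 2 - E 2 ^ 2) + (P 3 ^ 2 - E 3 ^ 2)) / 4 := by
    rw [meanSq, meanSq]; ring
  rw [e, norm_div, Complex.norm_ofNat, div_le_iff₀ (by norm_num)]
  refine (norm_add_le _ _).trans ?_
  have := norm_add₃_le (a := P 0 ^ 2 - E 0 ^ 2) (b := P 1 ^ 2 - E 1 ^ 2) (c := P 2 ^ 2 - E 2 ^ 2)
  linarith [key 0, key 1, key 2, key 3]

/-- The centroid norms eventually halve at each step, and a step moves the vertices by at most `4 *
‖g‖`; the geometric series sums to `8 * ‖g‖`. -/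
theorem dist_iterate_limit_le (h : Inscribed P)
    (hE : Tendsto (fun n => CyclicQuad.step^[n] P) atTop (𝓝 E)) (hm : meanSq E = 0) :
    ∀ᶠ n in atTop, dist (CyclicQuad.step^[n] P) E ≤ 8 * ‖centroid (CyclicQuad.step^[n] P)‖ := by
  have h1 : Tendsto (fun n => ‖meanSq (CyclicQuad.step^[n] P)‖) atTop (𝓝 0) := by
    simpa [hm] using ((continuous_meanSq.tendsto E).comp hE).norm
  have h2 : ∀ᶠ n in atTop, ‖centroid (CyclicQuad.step^[n + 1] P)‖ ≤
      1 / 2 * ‖centroid (CyclicQuad.step^[n] P)‖ ∧ ‖centroid (CyclicQuad.step^[n] P)‖ ≤ 1 / 2 := by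
    filter_upwards [h.norm_centroid_iterate_succ,
      h1.eventually (gt_mem_nhds (by norm_num : (0 : ℝ) < 1 / 4)),
      h.eventually_norm_centroid_le (ε := 1 / 16) (by norm_num)] with n a1 a2 a3
    have a4 := (abs_le.1 a1).2
    refine ⟨?_, by linarith⟩
    nlinarith [norm_nonneg (centroid (CyclicQuad.step^[n] P))]
  obtain ⟨N, hN⟩ := eventually_atTop.1 h2
  filter_upwards [eventually_ge_atTop N] with n hn
  have h3 : ∀ k, ‖centroid (CyclicQuad.step^[n + k] P)‖ ≤
      ‖centroid (CyclicQuad.step^[n] P)‖ * (1 / 2) ^ k := by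
    intro k
    induction k with
    | zero => simp
    | succ k ih =>
      refine (hN (n + k) (by omega)).1.trans ?_
      rw [pow_succ]
      linarith
  have h4 := dist_le_of_le_geometric_of_tendsto₀ (f := fun k => CyclicQuad.step^[n + k] P) (1 / 2)
    (4 * ‖centroid (CyclicQuad.step^[n] P)‖) (by norm_num) (fun k => ?_) (a := E)
    ((hE.comp (tendsto_add_atTop_nat n)).congr fun k => by rw [Function.comp_apply, add_comm])
  · norm_num at h4
    linarith
  · rw [← add_assoc, Function.iterate_succ_apply']
    have := (h.iterate (n + k)).dist_step_le (hN (n + k) (by omega)).2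
    linarith [h3 k]

theorem OG_isBigO (h : Inscribed P)
    (hE : Tendsto (fun n => CyclicQuad.step^[n] P) atTop (𝓝 E)) (hm : meanSq E = 0) :
    (fun n => OG P (n + 1)) =O[atTop] fun n => OG P n ^ 2 := by
  -- `20 = 2 * 8 + 4`: the bound on `‖meanSq‖` by the distance to the limit, plus the first-order
  -- error.
  refine IsBigO.of_bound 20 ?_
  filter_upwards [h.norm_centroid_iterate_succ, h.dist_iterate_limit_le hE hm] with n a1 a2
  rw [h.OG_eq, h.OG_eq, norm_norm, norm_pow, norm_norm]
  have a3 := (h.iterate n).norm_meanSq_sub_le (h.limit hE)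
  rw [hm, sub_zero] at a3
  have a4 := (abs_le.1 a1).2
  nlinarith [norm_nonneg (centroid (CyclicQuad.step^[n] P))]

/-- Weaker than the quadratic bound, because `OG P n ≤ 1`. -/
theorem OG_isBigO_rpow (h : Inscribed P)
    (hE : Tendsto (fun n => CyclicQuad.step^[n] P) atTop (𝓝 E)) (hm : meanSq E = 0) :
    (fun n => OG P (n + 1)) =O[atTop] fun n => OG P n ^ (3 / 2 : ℝ) := by
  refine (h.OG_isBigO hE hm).trans (IsBigO.of_bound 1 (Eventually.of_forall fun n => ?_))
  have h0 : 0 ≤ OG P n := dist_nonneg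
  have h1 : OG P n ≤ 1 := by rw [h.OG_eq]; exact (h.iterate n).norm_centroid_lt_one.le
  rw [one_mul, Real.norm_of_nonneg (by positivity), Real.norm_of_nonneg (by positivity),
    ← Real.rpow_natCast]
  exact Real.rpow_le_rpow_of_exponent_ge_of_imp h0 h1 (by norm_num) (by norm_num)

end Inscribed

end CyclicQuad

/-! ### Assembly of the theorem. -/

namespace CyclicQuad

open Filter Asymptotics Topology

namespace Inscribed

variable {P E : Fin 4 → ℂ}

theorem line_inter_circle_seq (h : Inscribed P) (n : ℕ) (i : Fin 4) :
    CyclicQuad.seq P n i ∈ circle ∧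
      CyclicQuad.seq P n i ≠ centroid (CyclicQuad.seq P n) ∧
      CyclicQuad.seq P (n + 1) i ≠ CyclicQuad.seq P n i ∧
      {z : ℂ | z ∈ line[ℝ, centroid (CyclicQuad.seq P n), CyclicQuad.seq P n i] ∧ z ∈ circle} =
        {CyclicQuad.seq P n i, CyclicQuad.seq P (n + 1) i} := by
  have hn := h.seq n
  have hg := hn.norm_centroid_lt_one
  have hs : CyclicQuad.seq P (n + 1) = next (CyclicQuad.seq P n) := by
    rw [CyclicQuad.seq, Function.iterate_succ_apply', ← CyclicQuad.seq]
  refine ⟨mem_circle_iff.2 (hn.norm_eq i),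
    sub_ne_zero.1 (sub_ne_zero_of_norm_lt (hn.norm_eq i) hg), ?_, ?_⟩
  · rw [hs, hn.next_eq]
    exact neg_mob_ne_self (hn.norm_eq i) hg
  · rw [hs]
    exact line_inter_circle (hn.norm_eq i)

theorem isBigO_dist_seq (h : Inscribed P)
    (hE : Tendsto (fun n => CyclicQuad.step^[n] P) atTop (𝓝 E)) {q : ℝ}
    (hq : ‖meanSq E‖ < q) (hq1 : q < 1) :
    (fun i => dist (CyclicQuad.seq P (2 * i)) E) =O[atTop] (fun i => q ^ i) ∧
      (fun i => dist (CyclicQuad.seq P (2 * i + 1)) (-E)) =O[atTop] (fun i => q ^ i) := by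
  have hq0 : 0 < q := (norm_nonneg _).trans_lt hq
  have h1 := h.isBigO_dist_iterate_limit hE hq hq1
  have h2 : Tendsto (fun i : ℕ => 2 * i) atTop atTop :=
    tendsto_atTop_mono (fun i => by simp only [id]; omega) tendsto_id
  have h3 : Tendsto (fun i : ℕ => 2 * i + 1) atTop atTop := (tendsto_add_atTop_nat 1).comp h2
  have key : ∀ f : ℕ → ℕ, (∀ i, i ≤ f i) → (fun i => q ^ f i) =O[atTop] fun i => q ^ i :=
    fun f hf => IsBigO.of_bound 1 (Eventually.of_forall fun i => by
      rw [one_mul, Real.norm_of_nonneg (by positivity), Real.norm_of_nonneg (by positivity)]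
      exact pow_le_pow_of_le_one hq0.le hq1.le (hf i))
  simp only [h.seq_even, h.seq_odd, dist_neg_neg]
  exact ⟨(h1.comp_tendsto h2).trans (key _ fun i => by omega),
    (h1.comp_tendsto h3).trans (key _ fun i => by omega)⟩

end Inscribed

end CyclicQuad

open Filter Asymptotics Topology in
theorem mainTheorem4 (T₀ : Fin 4 → ℂ)
    (hcyclic : ∀ i, T₀ i ∈ CyclicQuad.circle)
    (hdistinct : Function.Injective T₀)
    (hconvex : CyclicQuad.IsConvexQuad T₀) :
    -- the sequence is well defined and consists of convex quadrilaterals inscribed in the circle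
    (∀ n, Function.Injective (CyclicQuad.seq T₀ n) ∧
      CyclicQuad.IsConvexQuad (CyclicQuad.seq T₀ n) ∧
      ∀ i, CyclicQuad.seq T₀ n i ∈ CyclicQuad.circle ∧
        CyclicQuad.seq T₀ n i ≠ CyclicQuad.centroid (CyclicQuad.seq T₀ n) ∧
        CyclicQuad.seq T₀ (n + 1) i ≠ CyclicQuad.seq T₀ n i ∧
        {z : ℂ | z ∈ line[ℝ, CyclicQuad.centroid (CyclicQuad.seq T₀ n), CyclicQuad.seq T₀ n i] ∧
          z ∈ CyclicQuad.circle} = {CyclicQuad.seq T₀ n i, CyclicQuad.seq T₀ (n + 1) i}) ∧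
    ∃ E F : Fin 4 → ℂ,
      -- the subsequences of even and odd index converge to rectangles with the same image
      Tendsto (fun i => CyclicQuad.seq T₀ (2 * i)) atTop (𝓝 E) ∧
      Tendsto (fun i => CyclicQuad.seq T₀ (2 * i + 1)) atTop (𝓝 F) ∧
      CyclicQuad.IsLimitForm T₀ E ∧ CyclicQuad.IsLimitForm T₀ F ∧
      Set.range E = Set.range F ∧
      -- the limit is a square for both subsequences or for none
      (CyclicQuad.IsSquareQuad E ↔ CyclicQuad.IsSquareQuad F) ∧
      -- rates of convergence if the limit is not a square
      (¬ CyclicQuad.IsSquareQuad E →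
        ((fun n => CyclicQuad.OG T₀ (n + 1)) ~[atTop]
          fun n => |CyclicQuad.d E 0 1 - 2| / 2 * CyclicQuad.OG T₀ n) ∧
        ∃ q : ℝ, 0 < q ∧ q < 1 ∧
          (fun i => dist (CyclicQuad.seq T₀ (2 * i)) E) =O[atTop] (fun i => q ^ i) ∧
          (fun i => dist (CyclicQuad.seq T₀ (2 * i + 1)) F) =O[atTop] (fun i => q ^ i)) ∧
      -- rates of convergence if the limit is a square
      (CyclicQuad.IsSquareQuad E →
        ((fun n => CyclicQuad.OG T₀ (n + 1)) =O[atTop]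
          fun n => CyclicQuad.OG T₀ n ^ (3 / 2 : ℝ)) ∧
        ∀ q : ℝ, 0 < q → q < 1 →
          (fun i => dist (CyclicQuad.seq T₀ (2 * i)) E) =O[atTop] (fun i => q ^ i) ∧
          (fun i => dist (CyclicQuad.seq T₀ (2 * i + 1)) F) =O[atTop] (fun i => q ^ i)) := by
  have h : CyclicQuad.Inscribed T₀ :=
    ⟨fun i => CyclicQuad.mem_circle_iff.1 (hcyclic i), hdistinct⟩
  refine ⟨fun n => ⟨(h.seq n).injective, h.isConvexQuad_seq hconvex n,
    h.line_inter_circle_seq n⟩, ?_⟩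
  obtain ⟨E, hE⟩ := h.exists_tendsto_iterate
  have hiE := h.limit hE
  have hiF := hiE.neg
  have h0 := h.centroid_limit hE
  obtain ⟨h2, h3⟩ := hiE.antipodal h0 (h.orient_limit hconvex hE)
  have h2' : (-E) 2 = -(-E) 0 := by simp [h2]
  have h3' : (-E) 3 = -(-E) 1 := by simp [h3]
  have hd := h.d_limit hE h2 h3
  have h2i : Tendsto (fun i : ℕ => 2 * i) atTop atTop :=
    tendsto_atTop_mono (fun i => by simp only [id]; omega) tendsto_id
  have hsqE := hiE.isSquareQuad_iff h2 h3
  have hsqF := hiF.isSquareQuad_iff h2' h3'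
  have hneg : CyclicQuad.meanSq (-E) = CyclicQuad.meanSq E := by simp [CyclicQuad.meanSq]
  -- The odd terms are negated iterates, so they tend to `-E`; antipodality makes this a relabelling
  -- of `E`.
  refine ⟨E, -E, ?_, ?_, hiE.isLimitForm h0 h2 h3 hd, hiF.isLimitForm ?_ h2' h3' ?_, ?_, ?_, ?_, ?_⟩
  · simp only [h.seq_even]
    exact hE.comp h2i
  · simp only [h.seq_odd]
    exact (hE.comp ((tendsto_add_atTop_nat 1).comp h2i)).neg
  · rw [CyclicQuad.centroid_neg, h0, neg_zero]
  · rw [CyclicQuad.Inscribed.d_neg, hd]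
  · ext z
    simp [Fin.exists_fin_succ, h2, h3]
    tauto
  · rw [hsqE, hsqF, hneg]
  · intro hs
    rw [hsqE] at hs
    refine ⟨?_, ?_⟩
    · rw [← hiE.norm_meanSq h2 h3]
      exact h.OG_isEquivalent hE hs
    · obtain ⟨q, hq, hq1⟩ := exists_between (hiE.norm_meanSq_lt_one h2 h3)
      exact ⟨q, (norm_nonneg _).trans_lt hq, hq1, h.isBigO_dist_seq hE hq hq1⟩
  · intro hs
    rw [hsqE] at hs
    refine ⟨h.OG_isBigO_rpow hE hs, fun q hq hq1 => h.isBigO_dist_seq hE ?_ hq1⟩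
    rwa [hs, norm_zero]
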